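/- Let $P_0$ be a probability distribution on $\mathbb{R}$ with mean $\mu_0$. The exponential family based on $P_0$ consists of the distributions $P_\beta$ with $\frac{dP_\beta}{dP_0}(x)=\frac{\exp(\beta x)}{Z(\beta)}$, $Z(\beta)=\int\exp(\beta x)\,dP_0(x)<\infty$, together with its two end points, i.e. the weak limits of $P_\beta$ as $\beta\to-\infty$ and as $\beta\to+\infty$, when these limits exist and are probability distributions. Let $P^{x}$ denote the element of this family with mean value $x$, and let $D(Q\Vert P)=\int\ln\frac{dQ}{dP}\,dQ$ denote information divergence. The signed log-likelihood of the family based on $P_0$ is $$G_{P_0}(x)=\begin{cases}-\left[2D(P^{x}\Vert P_0)\right]^{1/2}, & x<\mu_0,\\ +\left[2D(P^{x}\Vert P_0)\right]^{1/2}, & x\ge\mu_0.\end{cases}$$ Let $\Phi$ denote the distribution function of the standard Gaussian distribution. (a) Let $n\ge 0$ be an integer, let $0<p<1$, and let $K$ be a random variable with the binomial distribution $bin(n,p)$. Then for every integer $k$ with $0\le k\le n$, $$\Pr(K<k)\le\Phi\left(G_{bin(n,p)}(k)\right)\le\Pr(K\le k).$$ (b) Let $\lambda>0$ and let $L$ be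 a random variable with the Poisson distribution $Po(\lambda)$. Then for every integer $k\ge 0$, $$\Pr(L<k)\le\Phi\left(G_{Po(\lambda)}(k)\right)\le\Pr(L\le k).$$ -/

import Mathlib

open MeasureTheory ProbabilityTheory Filter Topology
open scoped NNReal BoundedContinuousFunction

noncomputable section

/-- The member `P_β` of the natural exponential family based on `P₀`, with density
`exp (β * x) / Z β` with respect to `P₀`, where `Z β = ∫ exp (β * x) ∂P₀`. It is a probability
measure exactly when `exp (β * x)` is `P₀`-integrable. -/
def expFamily (P₀ : Measure ℝ) (β : ℝ) : Measure ℝ :=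
  P₀.tilted (fun x => β * x)

/-- `Q` is the weak limit of the members `P_β` of the exponential family based on `P₀`
as `β` tends along the filter `l` (used with `l = atBot` and `l = atTop`). -/
def IsExpFamilyLimit (P₀ : Measure ℝ) (l : Filter ℝ) (Q : Measure ℝ) : Prop :=
  ∀ f : ℝ →ᵇ ℝ, Tendsto (fun β => ∫ x, f x ∂(expFamily P₀ β)) l (𝓝 (∫ x, f x ∂Q))

/-- `Q` is an element with mean value `μ` of the exponential family based on `P₀`: either a
member `P_β`, or one of the two end points of the family, i.e. the weak limit of `P_β` as
`β → -∞` or `β → +∞`. (For instance `bin(n, 0)`, `bin(n, 1)` and `Po(0)` are the end points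
of the binomial and Poisson families.) -/
structure IsMeanValueMember (P₀ : Measure ℝ) (μ : ℝ) (Q : Measure ℝ) : Prop where
  isProbabilityMeasure : IsProbabilityMeasure Q
  mem : (∃ β : ℝ, Integrable (fun x => Real.exp (β * x)) P₀ ∧ Q = expFamily P₀ β) ∨
    IsExpFamilyLimit P₀ atBot Q ∨ IsExpFamilyLimit P₀ atTop Q
  integrable : Integrable (fun x : ℝ => x) Q
  mean : ∫ x, x ∂Q = μ

open Classical in
/-- The element `P^μ` with mean value `μ` of the exponential family based on `P₀`
(the zero measure if there is none). -/
def meanValueMember (P₀ : Measure ℝ) (μ : ℝ) : Measure ℝ :=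
  if h : ∃ Q, IsMeanValueMember P₀ μ Q then h.choose else 0

/-- The signed log-likelihood `G` of the exponential family based on `P₀`:
`G x = ± (2 D(P^x ‖ P₀))^(1/2)`, with the sign `-` for `x < μ₀` and `+` for `x ≥ μ₀`,
where `μ₀` is the mean value of `P₀`. -/
def signedLogLikelihood (P₀ : Measure ℝ) (x : ℝ) : ℝ :=
  if x < ∫ y, y ∂P₀ then
    -Real.sqrt (2 * (InformationTheory.klDiv (meanValueMember P₀ x) P₀).toReal)
  else
    Real.sqrt (2 * (InformationTheory.klDiv (meanValueMember P₀ x) P₀).toReal)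

/-- The binomial distribution `bin(n, p)`, as a measure on the real line. -/
def binReal (n : ℕ) (p : unitInterval) : Measure ℝ :=
  (binomial n p).map (Nat.cast : ℕ → ℝ)

/-- The Poisson distribution `Po(r)`, as a measure on the real line. -/
def poissonReal (r : ℝ≥0) : Measure ℝ :=
  (poissonMeasure r).map (Nat.cast : ℕ → ℝ)

/-- The distribution function `Φ` of the standard Gaussian. -/
def gaussianPhi (t : ℝ) : ℝ :=
  cdf (gaussianReal 0 1) t

end

/-! ### The standard Gaussian distribution function -/

/-! Fix `0 < k < n`, put `x = k / n`, and let the success probability `p` vary. With `D = D(Ber x ‖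
Ber p)` the signed log-likelihood `G` satisfies `G ^ 2 = 2 * n * D`, so the Gaussian density at `G`
is a constant times the binomial likelihood `p ^ k * (1 - p) ^ (n - k)`. The derivative in `p` of
`Pr(K ≤ k)` is also a multiple of `p ^ k * (1 - p) ^ (n - k - 1)`. Hence the derivative of `Pr(K ≤
k) - Φ(G)` is that power product times `A * √R - B`, where `A` and `B` are constants and `R = (x -
p) ^ 2 / (p ^ 2 * D)`.

The crux is that `R` decreases in `p` (`sq_div_bernoulliKL_antitone`). The difference therefore
first increases and then decreases; since it is asymptotically nonnegative at both ends of `(0, 1)`,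
it is nonnegative throughout (`nonneg_of_deriv_sign_antitone`). This is the upper bound. Exchanging
successes and failures turns it into the lower bound, and the limit of `bin(n, r / n)` gives the
Poisson case.

It remains to identify `signedLogLikelihood` with these explicit expressions. Interior means are
attained by exponential tilting, extreme means by point masses at the ends of the support. -/

lemma gaussianPhi_eq_real (t : ℝ) : gaussianPhi t = (gaussianReal 0 1).real (Set.Iic t) :=
  cdf_eq_real _ _

lemma gaussianPhi_nonneg (t : ℝ) : 0 ≤ gaussianPhi t := cdf_nonneg _ _

lemma gaussianPhi_le_one (t : ℝ) : gaussianPhi t ≤ 1 := cdf_le_one _ _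

lemma gaussianPhi_neg (t : ℝ) : gaussianPhi (-t) = 1 - gaussianPhi t := by
  have h : (gaussianReal 0 1).map (fun x => -x) = gaussianReal 0 1 := by
    simp [gaussianReal_map_neg]
  rw [gaussianPhi_eq_real, gaussianPhi_eq_real, ← h,
    map_measureReal_apply (by fun_prop) measurableSet_Iic, h]
  have h2 : (fun x : ℝ => -x) ⁻¹' Set.Iic (-t) = Set.Ici t := by ext; simp
  have : NullSingletonClass (gaussianReal 0 1) := nullSingletonClass_gaussianReal one_ne_zero
  rw [h2, ← probReal_compl_eq_one_sub measurableSet_Iic, Set.compl_Iic,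
    measureReal_congr Ioi_ae_eq_Ici]

/-- The Chernoff bound. At `t = √(2 * d)` it reads `exp (-d)`, which is exactly what `k = 0`
requires and what makes `Φ(G)` vanish as `p → 1`. -/
lemma gaussianPhi_neg_le (t : ℝ) (ht : 0 ≤ t) : gaussianPhi (-t) ≤ Real.exp (-t ^ 2 / 2) := by
  have h : HasSubgaussianMGF id 1 (gaussianReal 0 1) :=
    ⟨fun t => integrable_exp_mul_gaussianReal t, fun t => by simp [mgf_id_gaussianReal]⟩
  have h2 := h.measure_ge_le ht
  rw [gaussianPhi_neg, gaussianPhi_eq_real, ← probReal_compl_eq_one_sub measurableSet_Iic]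
  refine (measureReal_mono ?_).trans (h2.trans (le_of_eq (by simp)))
  intro y hy
  simp only [Set.compl_Iic, Set.mem_Ioi] at hy
  exact hy.le

lemma hasDerivAt_gaussianPhi (t : ℝ) :
    HasDerivAt gaussianPhi ((√(2 * Real.pi))⁻¹ * Real.exp (-t ^ 2 / 2)) t := by
  have hint := integrable_gaussianPDFReal 0 1
  have h : gaussianPhi = fun u => ∫ y in Set.Iic u, gaussianPDFReal 0 1 y := by
    funext u
    rw [gaussianPhi_eq_real, measureReal_def, gaussianReal_apply_eq_integral 0 one_ne_zero,
      ENNReal.toReal_ofReal (integral_nonneg fun _ => gaussianPDFReal_nonneg _ _ _)]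
  have hc : Continuous (gaussianPDFReal 0 1) := by
    unfold gaussianPDFReal; fun_prop
  have h2 : gaussianPhi = fun u => (∫ y in Set.Iic 0, gaussianPDFReal 0 1 y)
      + ∫ y in (0:ℝ)..u, gaussianPDFReal 0 1 y := by
    funext u
    rw [h, ← intervalIntegral.integral_Iic_sub_Iic hint.integrableOn hint.integrableOn]
    ring
  rw [h2]
  have h3 := (hc.integral_hasStrictDerivAt 0 t).hasDerivAt.const_add
    (∫ y in Set.Iic 0, gaussianPDFReal 0 1 y)
  exact h3.congr_deriv (by simp [gaussianPDFReal])

lemma continuous_gaussianPhi : Continuous gaussianPhi :=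
  continuous_iff_continuousAt.2 fun t => (hasDerivAt_gaussianPhi t).continuousAt

/-! ### Functions whose derivative changes sign once -/

/-- The exceptional point is where the signed root changes branch; continuity there allows
monotonicity to be glued across it. -/
lemma le_of_hasDerivAt_nonneg_off_point {f f' : ℝ → ℝ} {a b : ℝ} (x : ℝ) (hab : a ≤ b)
    (hf : ContinuousOn f (Set.Icc a b))
    (hd : ∀ p ∈ Set.Ioo a b, p ≠ x → HasDerivAt f (f' p) p)
    (hn : ∀ p ∈ Set.Ioo a b, p ≠ x → 0 ≤ f' p) : f a ≤ f b := by
  have key : ∀ c d, a ≤ c → d ≤ b → c ≤ d → x ∉ Set.Ioo c d → f c ≤ f d := by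
    intro c d hac hdb hcd hx
    have hm : MonotoneOn f (Set.Icc c d) := by
      refine monotoneOn_of_hasDerivWithinAt_nonneg (f' := f') (convex_Icc c d)
        (hf.mono (Set.Icc_subset_Icc hac hdb)) ?_ ?_
      · intro p hp
        rw [interior_Icc] at hp
        exact (hd p ⟨hac.trans_lt hp.1, hp.2.trans_le hdb⟩
          (fun h => hx (h ▸ hp))).hasDerivWithinAt
      · intro p hp
        rw [interior_Icc] at hp
        exact hn p ⟨hac.trans_lt hp.1, hp.2.trans_le hdb⟩ (fun h => hx (h ▸ hp))
    exact hm ⟨le_rfl, hcd⟩ ⟨hcd, le_rfl⟩ hcd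
  by_cases hx : x ∈ Set.Ioo a b
  · exact (key a x le_rfl hx.2.le hx.1.le (by simp)).trans
      (key x b hx.1.le le_rfl hx.2.le (by simp))
  · exact key a b le_rfl le_rfl hab hx

/-- A function on `(0, 1)` whose derivative is a positive multiple of a decreasing function, and
which is asymptotically nonnegative at both ends, is nonnegative. -/
lemma nonneg_of_deriv_sign_antitone {f w s : ℝ → ℝ} (x : ℝ)
    (hf : ContinuousOn f (Set.Ioo 0 1))
    (hd : ∀ p ∈ Set.Ioo (0:ℝ) 1, p ≠ x → HasDerivAt f (w p * s p) p)
    (hw : ∀ p ∈ Set.Ioo (0:ℝ) 1, 0 ≤ w p)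
    (hs : ∀ p ∈ Set.Ioo (0:ℝ) 1, ∀ q ∈ Set.Ioo (0:ℝ) 1, p ≠ x → q ≠ x → p ≤ q → s q ≤ s p)
    (h0 : ∀ ε > 0, ∀ᶠ p in 𝓝[>] (0:ℝ), -ε < f p)
    (h1 : ∀ ε > 0, ∀ᶠ p in 𝓝[<] (1:ℝ), -ε < f p) {q : ℝ} (hq : q ∈ Set.Ioo (0:ℝ) 1) :
    0 ≤ f q := by
  by_contra! hneg
  obtain ⟨a, ha, ha'⟩ := ((h0 (-f q) (by linarith)).and (Ioo_mem_nhdsGT hq.1)).exists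
  obtain ⟨b, hb, hb'⟩ := ((h1 (-f q) (by linarith)).and (Ioo_mem_nhdsLT hq.2)).exists
  rw [neg_neg] at ha hb
  -- If `s` is negative somewhere before `q`, it stays negative, so `f` decreases from `q` to `b`;
  -- otherwise `f` increases from `a` to `q`. Either contradicts `f q < f a, f b`.
  by_cases h : ∃ y ∈ Set.Ioo 0 q, y ≠ x ∧ s y < 0
  · obtain ⟨y, hy, hyx, hsy⟩ := h
    have := le_of_hasDerivAt_nonneg_off_point (f := fun p => -f p) (f' := fun p => -(w p * s p))
      x hb'.1.le ((hf.mono fun z hz => ⟨hq.1.trans_le hz.1, hz.2.trans_lt hb'.2⟩).neg)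
      (fun p hp hpx => (hd p ⟨hq.1.trans hp.1, hp.2.trans hb'.2⟩ hpx).neg)
      (fun p hp hpx => by
        have hp' : p ∈ Set.Ioo (0:ℝ) 1 := ⟨hq.1.trans hp.1, hp.2.trans hb'.2⟩
        have h2 := hs y ⟨hy.1, hy.2.trans hq.2⟩ p hp' hyx hpx (hy.2.trans hp.1).le
        have := mul_nonneg (hw p hp') (show 0 ≤ - s p by linarith)
        linarith)
    linarith
  · push Not at h
    have := le_of_hasDerivAt_nonneg_off_point (f := f) (f' := fun p => (w p * s p))
      x ha'.2.le (hf.mono fun z hz => ⟨ha'.1.trans_le hz.1, hz.2.trans_lt hq.2⟩)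
      (fun p hp hpx => hd p ⟨ha'.1.trans hp.1, hp.2.trans hq.2⟩ hpx)
      (fun p hp hpx => mul_nonneg (hw p ⟨ha'.1.trans hp.1, hp.2.trans hq.2⟩)
        (h p ⟨ha'.1.trans hp.1, hp.2⟩ hpx))
    linarith

/-! ### The divergence between Bernoulli distributions -/

/-- The divergence `D(Ber x ‖ Ber p)`. -/
noncomputable def bernoulliKL (x p : ℝ) : ℝ :=
  x * Real.log (x / p) + (1 - x) * Real.log ((1 - x) / (1 - p))

section

variable {x : ℝ}

lemma bernoulliKL_self (hx : x ∈ Set.Ioo (0:ℝ) 1) : bernoulliKL x x = 0 := by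
  have h1 : x ≠ 0 := hx.1.ne'
  have h2 : 1 - x ≠ 0 := (sub_pos.2 hx.2).ne'
  simp [bernoulliKL, h1, h2]

lemma bernoulliKL_one_sub (x p : ℝ) : bernoulliKL (1 - x) (1 - p) = bernoulliKL x p := by
  simp only [bernoulliKL, sub_sub_cancel]; ring

lemma hasDerivAt_bernoulliKL (hx : x ∈ Set.Ioo (0:ℝ) 1) {p : ℝ} (hp : p ∈ Set.Ioo (0:ℝ) 1) :
    HasDerivAt (bernoulliKL x) ((p - x) / (p * (1 - p))) p := by
  have h1 : x ≠ 0 := hx.1.ne'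
  have h2 : 1 - x ≠ 0 := (sub_pos.2 hx.2).ne'
  have h3 : p ≠ 0 := hp.1.ne'
  have h4 : 1 - p ≠ 0 := (sub_pos.2 hp.2).ne'
  have e1 := (((hasDerivAt_id p).fun_inv h3).const_mul x).log (mul_ne_zero h1 (inv_ne_zero h3))
  have e2 := ((((hasDerivAt_id p).const_sub 1).fun_inv h4).const_mul (1 - x)).log
    (mul_ne_zero h2 (inv_ne_zero h4))
  refine ((e1.const_mul x).add (e2.const_mul (1 - x))).congr_deriv ?_ |>.congr_of_eventuallyEq ?_
  · simp only [id]
    field_simp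
    ring
  · exact Eventually.of_forall fun y => by simp [bernoulliKL, div_eq_mul_inv]

/-- This expression vanishes at `p = x`, so it has the sign of `x - p`. It is the factor deciding
the sign of the derivative of `R`. -/
lemma antitoneOn_two_mul_bernoulliKL_sub (hx : x ∈ Set.Ioo (0:ℝ) 1) :
    AntitoneOn (fun p => 2 * x * bernoulliKL x p - (x - p) ^ 2 / (1 - p)) (Set.Ioo 0 1) := by
  have hd : ∀ p ∈ Set.Ioo (0:ℝ) 1,
      HasDerivAt (fun p => 2 * x * bernoulliKL x p - (x - p) ^ 2 / (1 - p))
        (-((p - x) ^ 2 * (2 - p) / (p * (1 - p) ^ 2))) p := by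
    intro p hp
    have h3 : p ≠ 0 := hp.1.ne'
    have h4 : 1 - p ≠ 0 := (sub_pos.2 hp.2).ne'
    refine (((hasDerivAt_bernoulliKL hx hp).const_mul (2 * x)).sub
      ((((hasDerivAt_id p).const_sub x).fun_pow 2).fun_div
        ((hasDerivAt_id p).const_sub 1) h4)).congr_deriv ?_
    simp only [id]
    field_simp
    ring
  refine antitoneOn_of_hasDerivWithinAt_nonpos (convex_Ioo 0 1)
    (fun p hp => (hd p hp).continuousAt.continuousWithinAt)
    (fun p hp => (hd p (interior_subset hp)).hasDerivWithinAt) ?_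
  intro p hp
  have hp := interior_subset hp
  have h3 : 0 < p := hp.1
  have h4 : 0 < 1 - p := sub_pos.2 hp.2
  have h5 : 0 < 2 - p := by linarith
  rw [neg_nonpos]
  positivity

/-- The constant `2 * (1 - x) / x` is the limit of `R` as `p → x`. Vanishing at `p = x`, this
function compares `R` with that limit on either side. -/
lemma monotoneOn_bernoulliKL_sub (hx : x ∈ Set.Ioo (0:ℝ) 1) :
    MonotoneOn (fun p => 2 * (1 - x) / x * bernoulliKL x p - (x - p) ^ 2 / p ^ 2)
      (Set.Ioo 0 1) := by
  have h1 : 0 < x := hx.1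
  have h2 : 0 < 1 - x := sub_pos.2 hx.2
  have hd : ∀ p ∈ Set.Ioo (0:ℝ) 1,
      HasDerivAt (fun p => 2 * (1 - x) / x * bernoulliKL x p - (x - p) ^ 2 / p ^ 2)
        (2 * (p - x) ^ 2 * ((1 - x) * p + x) / (p ^ 3 * (1 - p) * x)) p := by
    intro p hp
    have h3 : p ≠ 0 := hp.1.ne'
    have h4 : 1 - p ≠ 0 := (sub_pos.2 hp.2).ne'
    refine (((hasDerivAt_bernoulliKL hx hp).const_mul (2 * (1 - x) / x)).sub
      ((((hasDerivAt_id p).const_sub x).fun_pow 2).fun_div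
        ((hasDerivAt_id p).fun_pow 2) (pow_ne_zero 2 h3))).congr_deriv ?_
    simp only [id]
    field_simp
    ring
  refine monotoneOn_of_hasDerivWithinAt_nonneg (convex_Ioo 0 1)
    (fun p hp => (hd p hp).continuousAt.continuousWithinAt)
    (fun p hp => (hd p (interior_subset hp)).hasDerivWithinAt) ?_
  intro p hp
  have hp := interior_subset hp
  have h3 : 0 < p := hp.1
  have h4 : 0 < 1 - p := sub_pos.2 hp.2
  positivity

lemma sq_div_le_of_lt (hx : x ∈ Set.Ioo (0:ℝ) 1) {p : ℝ} (hp : 0 < p) (hpx : p ≤ x) :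
    (x - p) ^ 2 / (1 - p) ≤ 2 * x * bernoulliKL x p := by
  have := antitoneOn_two_mul_bernoulliKL_sub hx ⟨hp, hpx.trans_lt hx.2⟩ hx hpx
  simp only [bernoulliKL_self hx] at this
  simp at this
  linarith

lemma le_sq_div_of_gt (hx : x ∈ Set.Ioo (0:ℝ) 1) {p : ℝ} (hp : p < 1) (hpx : x ≤ p) :
    2 * x * bernoulliKL x p ≤ (x - p) ^ 2 / (1 - p) := by
  have := antitoneOn_two_mul_bernoulliKL_sub hx hx ⟨hx.1.trans_le hpx, hp⟩ hpx
  simp only [bernoulliKL_self hx] at this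
  simp at this
  linarith

lemma le_sq_div_sq_of_lt (hx : x ∈ Set.Ioo (0:ℝ) 1) {p : ℝ} (hp : 0 < p) (hpx : p ≤ x) :
    2 * (1 - x) / x * bernoulliKL x p ≤ (x - p) ^ 2 / p ^ 2 := by
  have := monotoneOn_bernoulliKL_sub hx ⟨hp, hpx.trans_lt hx.2⟩ hx hpx
  simp only [bernoulliKL_self hx] at this
  simp at this
  linarith

lemma sq_div_sq_le_of_gt (hx : x ∈ Set.Ioo (0:ℝ) 1) {p : ℝ} (hp : p < 1) (hpx : x ≤ p) :
    (x - p) ^ 2 / p ^ 2 ≤ 2 * (1 - x) / x * bernoulliKL x p := by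
  have := monotoneOn_bernoulliKL_sub hx hx ⟨hx.1.trans_le hpx, hp⟩ hpx
  simp only [bernoulliKL_self hx] at this
  simp at this
  linarith

lemma bernoulliKL_pos (hx : x ∈ Set.Ioo (0:ℝ) 1) {p : ℝ} (hp : p ∈ Set.Ioo (0:ℝ) 1)
    (hpx : p ≠ x) : 0 < bernoulliKL x p := by
  have h0 : 0 < x := hx.1
  have h1 : 0 < 1 - x := sub_pos.2 hx.2
  have h2 : 0 < p := hp.1
  have h3 : 0 < 1 - p := sub_pos.2 hp.2
  have h4 : 0 < (x - p) ^ 2 := by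
    have := sub_ne_zero.2 hpx.symm
    positivity
  rcases hpx.lt_or_gt with h | h
  · have := (div_pos h4 h3).trans_le (sq_div_le_of_lt hx hp.1 h.le)
    exact pos_of_mul_pos_right this (by positivity)
  · have := (div_pos h4 (pow_pos h2 2)).trans_le (sq_div_sq_le_of_gt hx hp.2 h.le)
    exact pos_of_mul_pos_right this (by positivity)

lemma bernoulliKL_nonneg (hx : x ∈ Set.Ioo (0:ℝ) 1) {p : ℝ} (hp : p ∈ Set.Ioo (0:ℝ) 1) :
    0 ≤ bernoulliKL x p := by
  by_cases h : p = x
  · rw [h, bernoulliKL_self hx]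
  · exact (bernoulliKL_pos hx hp h).le

/-- The ratio `(x - p) ^ 2 / (p ^ 2 * D(Ber x ‖ Ber p))` decreases in `p`. -/
lemma sq_div_bernoulliKL_antitone (hx : x ∈ Set.Ioo (0:ℝ) 1) {p q : ℝ}
    (hp : p ∈ Set.Ioo (0:ℝ) 1) (hq : q ∈ Set.Ioo (0:ℝ) 1) (hpx : p ≠ x) (hqx : q ≠ x)
    (hpq : p ≤ q) :
    (x - q) ^ 2 / (q ^ 2 * bernoulliKL x q) ≤ (x - p) ^ 2 / (p ^ 2 * bernoulliKL x p) := by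
  have hd : ∀ p ∈ Set.Ioo (0:ℝ) 1, p ≠ x →
      HasDerivAt (fun p => (x - p) ^ 2 / (p ^ 2 * bernoulliKL x p))
        (-((x - p) * p * (2 * x * bernoulliKL x p - (x - p) ^ 2 / (1 - p))) /
          (p ^ 2 * bernoulliKL x p) ^ 2) p := by
    intro p hp hpx
    have h3 : p ≠ 0 := hp.1.ne'
    have h4 : 1 - p ≠ 0 := (sub_pos.2 hp.2).ne'
    have h5 := (bernoulliKL_pos hx hp hpx).ne'
    refine ((((hasDerivAt_id p).const_sub x).fun_pow 2).fun_div
        (((hasDerivAt_id p).fun_pow 2).fun_mul (hasDerivAt_bernoulliKL hx hp))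
        (mul_ne_zero (pow_ne_zero 2 h3) h5)).congr_deriv ?_
    simp only [id]
    field_simp
    ring
  have hn : ∀ p ∈ Set.Ioo (0:ℝ) 1,
      0 ≤ (x - p) * p * (2 * x * bernoulliKL x p - (x - p) ^ 2 / (1 - p)) := by
    intro p hp
    rcases le_total p x with h | h
    · have := sq_div_le_of_lt hx hp.1 h
      exact mul_nonneg (mul_nonneg (by linarith) hp.1.le) (by linarith)
    · have := le_sq_div_of_gt hx hp.2 h
      exact mul_nonneg_of_nonpos_of_nonpos
        (mul_nonpos_of_nonpos_of_nonneg (by linarith) hp.1.le) (by linarith)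
  have key : (x ∉ Set.Icc p q) →
      (x - q) ^ 2 / (q ^ 2 * bernoulliKL x q) ≤ (x - p) ^ 2 / (p ^ 2 * bernoulliKL x p) := by
    intro hxpq
    have hsub : ∀ y ∈ Set.Icc p q, y ∈ Set.Ioo (0:ℝ) 1 ∧ y ≠ x := fun y hy =>
      ⟨⟨hp.1.trans_le hy.1, hy.2.trans_lt hq.2⟩, fun h => hxpq (h ▸ hy)⟩
    have hanti := antitoneOn_of_hasDerivWithinAt_nonpos (convex_Icc p q)
      (fun y hy => (hd y (hsub y hy).1 (hsub y hy).2).continuousAt.continuousWithinAt)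
      (fun y hy => (hd y (hsub y (interior_subset hy)).1
        (hsub y (interior_subset hy)).2).hasDerivWithinAt)
      (fun y hy => div_nonpos_of_nonpos_of_nonneg
        (neg_nonpos.2 (hn y (hsub y (interior_subset hy)).1)) (by positivity))
    exact hanti ⟨le_rfl, hpq⟩ ⟨hpq, le_rfl⟩ hpq
  -- At `x` the quotient is `0 / 0`, so monotonicity cannot be chained through `x`; the value `2 *
  -- (1 - x) / x` separates the two sides instead.
  by_cases hxpq : x ∈ Set.Icc p q
  · have hp0 : 0 < p := hp.1
    have hq0 : 0 < q := hq.1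
    have h1 := le_sq_div_sq_of_lt hx hp.1 hxpq.1
    have h2 := sq_div_sq_le_of_gt hx hq.2 hxpq.2
    rw [← div_div, ← div_div]
    exact ((div_le_iff₀ (bernoulliKL_pos hx hq hqx)).2 h2).trans
      ((le_div_iff₀ (bernoulliKL_pos hx hp hpx)).2 h1)
  · exact key hxpq

end

/-! ### Signed roots -/

/-- The square root of `2 * d`, with sign `-` for `x < m` and `+` for `x ≥ m`. -/
noncomputable def signedRoot (x m d : ℝ) : ℝ :=
  if x < m then -√(2 * d) else √(2 * d)

lemma signedRoot_sq (x m : ℝ) {d : ℝ} (hd : 0 ≤ d) : signedRoot x m d ^ 2 = 2 * d := by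
  have : √(2 * d) ^ 2 = 2 * d := Real.sq_sqrt (by positivity)
  unfold signedRoot
  split_ifs <;> simpa only [neg_sq] using this

lemma gaussianPhi_neg_sqrt_le {d : ℝ} (hd : 0 ≤ d) :
    gaussianPhi (-√(2 * d)) ≤ Real.exp (-d) := by
  refine (gaussianPhi_neg_le _ (Real.sqrt_nonneg _)).trans (le_of_eq ?_)
  rw [Real.sq_sqrt (by positivity)]
  congr 1
  ring

/-! ### The binomial distribution function -/

/-- The probability that a binomial variable is at most `k`. -/
noncomputable def binomialSum (n k : ℕ) (p : ℝ) : ℝ :=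
  ∑ j ∈ Finset.range (k + 1), n.choose j * p ^ j * (1 - p) ^ (n - j)

/-- The termwise derivatives telescope, by `(k + 1) * C(n, k + 1) = (n - k) * C(n, k)`. For `k ≥ n`
the truncated `n - k` correctly gives derivative `0`. -/
lemma hasDerivAt_binomialSum (n k : ℕ) (p : ℝ) :
    HasDerivAt (binomialSum n k)
      (-((n - k : ℕ) * n.choose k * (p ^ k * (1 - p) ^ (n - k - 1)))) p := by
  have hterm : ∀ j, HasDerivAt (fun p : ℝ => n.choose j * p ^ j * (1 - p) ^ (n - j))
      (n.choose j * (j * p ^ (j - 1)) * (1 - p) ^ (n - j) -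
        n.choose j * p ^ j * ((n - j : ℕ) * (1 - p) ^ (n - j - 1))) p := by
    intro j
    refine ((((hasDerivAt_id p).fun_pow j).const_mul _).fun_mul
      (((hasDerivAt_id p).const_sub 1).fun_pow (n - j))).congr_deriv ?_
    simp only [id]
    ring
  induction k with
  | zero =>
    refine (hterm 0).congr_deriv ?_ |>.congr_of_eventuallyEq ?_
    · simp
    · exact Eventually.of_forall fun y => by simp [binomialSum]
  | succ k ih =>
    refine (ih.add (hterm (k + 1))).congr_deriv ?_ |>.congr_of_eventuallyEq ?_
    · have h : (n.choose (k + 1) : ℝ) * (k + 1) = n.choose k * (n - k : ℕ) := by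
        exact_mod_cast Nat.choose_succ_right_eq n k
      have e : n - k - 1 = n - (k + 1) := by omega
      rw [e, Nat.add_sub_cancel]
      push_cast
      linear_combination p ^ k * (1 - p) ^ (n - (k + 1)) * h
    · exact Eventually.of_forall fun y => by
        simp [binomialSum, Finset.sum_range_succ _ (k + 1)]

/-- The likelihood ratio: this lets the Gaussian density at `G` share its `p`-dependence with the
derivative of `binomialSum`. -/
lemma exp_neg_mul_bernoulliKL {n k : ℕ} (hk : 0 < k) (hkn : k < n) {p : ℝ}
    (hp : p ∈ Set.Ioo (0:ℝ) 1) :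
    Real.exp (-(n * bernoulliKL (k / n) p)) =
      (((k : ℝ) / n) ^ k * (1 - (k : ℝ) / n) ^ (n - k))⁻¹ * (p ^ k * (1 - p) ^ (n - k)) := by
  have hk' : (0:ℝ) < k := by exact_mod_cast hk
  have hn' : (0:ℝ) < n := by exact_mod_cast hk.trans hkn
  have hkn' : (k:ℝ) < n := by exact_mod_cast hkn
  have h1 : 0 < (k:ℝ) / n := by positivity
  have h2 : 0 < 1 - (k:ℝ) / n := by rw [sub_pos, div_lt_one hn']; exact hkn'
  have h3 : 0 < p := hp.1
  have h4 : 0 < 1 - p := sub_pos.2 hp.2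
  have e : -(n * bernoulliKL (k / n) p) =
      k * Real.log (p / (k / n)) + (n - k : ℕ) * Real.log ((1 - p) / (1 - k / n)) := by
    rw [bernoulliKL, ← inv_div p, ← inv_div (1 - p), Real.log_inv, Real.log_inv,
      Nat.cast_sub hkn.le]
    field_simp
    ring
  rw [e, Real.exp_add, Real.exp_nat_mul, Real.exp_nat_mul, Real.exp_log (by positivity),
    Real.exp_log (by positivity), div_pow p, div_pow (1 - p), div_mul_div_comm, div_eq_inv_mul]

section

variable {x : ℝ}

lemma continuousOn_signedRoot_bernoulliKL (hx : x ∈ Set.Ioo (0:ℝ) 1) (c : ℝ) :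
    ContinuousOn (fun p => signedRoot x p (c * bernoulliKL x p)) (Set.Ioo 0 1) := by
  have hc : ContinuousOn (bernoulliKL x) (Set.Ioo 0 1) := fun p hp =>
    (hasDerivAt_bernoulliKL hx hp).continuousAt.continuousWithinAt
  -- One of the two roots always vanishes, since `bernoulliKL x x = 0`; this form is continuous
  -- across `p = x` without gluing.
  have e : (fun p => signedRoot x p (c * bernoulliKL x p)) = fun p =>
      √(2 * (c * bernoulliKL x (min p x))) - √(2 * (c * bernoulliKL x (max p x))) := by
    funext p
    unfold signedRoot
    split_ifs with h
    · simp [h.le, bernoulliKL_self hx]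
    · simp [not_lt.1 h, bernoulliKL_self hx]
  rw [e]
  refine ContinuousOn.sub ?_ ?_
  · refine (((hc.comp (f := fun p => min p x) (by fun_prop) ?_).const_mul c).const_mul 2).sqrt
    exact fun p hp => ⟨lt_min hp.1 hx.1, (min_le_left _ _).trans_lt hp.2⟩
  · refine (((hc.comp (f := fun p => max p x) (by fun_prop) ?_).const_mul c).const_mul 2).sqrt
    exact fun p hp => ⟨hp.1.trans_le (le_max_left _ _), max_lt hp.2 hx.2⟩

/-- Apart from `1 / (1 - p)`, the variable `p` enters only through the decreasing ratio. The factor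
`1 / (1 - p)` lowers the exponent `n - k` of the likelihood to `n - k - 1`. -/
lemma hasDerivAt_signedRoot_bernoulliKL (hx : x ∈ Set.Ioo (0:ℝ) 1) {c : ℝ} (hc : 0 < c) {p : ℝ}
    (hp : p ∈ Set.Ioo (0:ℝ) 1) (hpx : p ≠ x) :
    HasDerivAt (fun p => signedRoot x p (c * bernoulliKL x p))
      (-(c / (1 - p) * √((x - p) ^ 2 / (p ^ 2 * bernoulliKL x p) / (2 * c)))) p := by
  have hH := bernoulliKL_pos hx hp hpx
  have h3 : 0 < p := hp.1
  have h4 : 0 < 1 - p := sub_pos.2 hp.2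
  have hd := (((hasDerivAt_bernoulliKL hx hp).const_mul c).const_mul 2).sqrt
    (by positivity)
  have e : √((x - p) ^ 2 / (p ^ 2 * bernoulliKL x p) / (2 * c)) =
      |x - p| / (p * √(2 * (c * bernoulliKL x p))) := by
    rw [← Real.sqrt_sq_eq_abs, ← Real.sqrt_sq h3.le, ← Real.sqrt_mul (by positivity),
      ← Real.sqrt_div (by positivity), Real.sqrt_sq h3.le]
    congr 1
    field_simp
  have hs : √(2 * (c * bernoulliKL x p)) ≠ 0 := by positivity
  rw [e]
  rcases hpx.lt_or_gt with h | h
  · refine hd.congr_deriv ?_ |>.congr_of_eventuallyEq ?_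
    · rw [abs_of_pos (sub_pos.2 h)]
      field_simp
      ring
    · filter_upwards [Iio_mem_nhds h] with y hy
      simp only [signedRoot, if_neg (not_lt.2 (le_of_lt (Set.mem_Iio.1 hy)))]
  · refine hd.neg.congr_deriv ?_ |>.congr_of_eventuallyEq ?_
    · rw [abs_of_neg (sub_neg.2 h)]
      field_simp
      ring
    · filter_upwards [Ioi_mem_nhds h] with y hy
      simp only [signedRoot, if_pos (Set.mem_Ioi.1 hy), Pi.neg_apply]

end

lemma binomialSum_zero (n k : ℕ) : binomialSum n k 0 = 1 := by
  rw [binomialSum, Finset.sum_range_succ']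
  simp

lemma binomialSum_nonneg (n k : ℕ) {p : ℝ} (h0 : 0 ≤ p) (h1 : p ≤ 1) :
    0 ≤ binomialSum n k p := by
  have : 0 ≤ 1 - p := sub_nonneg.2 h1
  exact Finset.sum_nonneg fun j _ => by positivity

lemma continuous_binomialSum (n k : ℕ) : Continuous (binomialSum n k) :=
  continuous_iff_continuousAt.2 fun p => (hasDerivAt_binomialSum n k p).continuousAt

lemma gaussianPhi_signedRoot_le_binomialSum_of_pos {n k : ℕ} (hk : 0 < k) (hkn : k < n) {p : ℝ}
    (hp : p ∈ Set.Ioo (0:ℝ) 1) :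
    gaussianPhi (signedRoot (k / n) p (n * bernoulliKL (k / n) p)) ≤ binomialSum n k p := by
  have hk' : (0:ℝ) < k := by exact_mod_cast hk
  have hn' : (0:ℝ) < n := by exact_mod_cast hk.trans hkn
  have hkn' : (k:ℝ) < n := by exact_mod_cast hkn
  have hx : (k:ℝ) / n ∈ Set.Ioo (0:ℝ) 1 := ⟨by positivity, by rwa [div_lt_one hn']⟩
  set x : ℝ := (k:ℝ) / n with hxdef
  set M : ℝ := (x ^ k * (1 - x) ^ (n - k))⁻¹ with hM
  have hM0 : 0 < M := by
    have := hx.1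
    have : 0 < 1 - x := sub_pos.2 hx.2
    positivity
  have hcont : ContinuousOn
      (fun p => binomialSum n k p - gaussianPhi (signedRoot x p (n * bernoulliKL x p)))
      (Set.Ioo 0 1) :=
    (continuous_binomialSum n k).continuousOn.sub
      (continuous_gaussianPhi.comp_continuousOn (continuousOn_signedRoot_bernoulliKL hx n))
  have hderiv : ∀ p ∈ Set.Ioo (0:ℝ) 1, p ≠ x → HasDerivAt
      (fun p => binomialSum n k p - gaussianPhi (signedRoot x p (n * bernoulliKL x p)))
      ((p ^ k * (1 - p) ^ (n - k - 1)) *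
        ((√(2 * Real.pi))⁻¹ * M * n * √((x - p) ^ 2 / (p ^ 2 * bernoulliKL x p) / (2 * n))
          - (n - k : ℕ) * n.choose k)) p := by
    intro p hp hpx
    have h4 : 0 < 1 - p := sub_pos.2 hp.2
    refine ((hasDerivAt_binomialSum n k p).sub ((hasDerivAt_gaussianPhi _).comp p
      (hasDerivAt_signedRoot_bernoulliKL hx hn' hp hpx))).congr_deriv ?_
    rw [signedRoot_sq _ _ (mul_nonneg hn'.le (bernoulliKL_nonneg hx hp)), neg_div,
      mul_div_cancel_left₀ _ two_ne_zero, exp_neg_mul_bernoulliKL hk hkn hp,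
      show (1 - p) ^ (n - k) = (1 - p) ^ (n - k - 1) * (1 - p) by
        rw [← pow_succ, show n - k - 1 + 1 = n - k by omega], ← hM]
    generalize √((x - p) ^ 2 / (p ^ 2 * bernoulliKL x p) / (2 * n)) = R
    field_simp
    ring
  refine sub_nonneg.1 (nonneg_of_deriv_sign_antitone x hcont hderiv ?_ ?_ ?_ ?_ hp)
  · intro p hp
    have := hp.1
    have h4 : 0 < 1 - p := sub_pos.2 hp.2
    positivity
  · intro p hp q hq hpx hqx hpq
    have := sq_div_bernoulliKL_antitone hx hp hq hpx hqx hpq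
    gcongr
  -- As `p → 0` the binomial sum tends to `1`, and `Φ ≤ 1`.
  · intro ε hε
    have h : ∀ᶠ p in 𝓝[>] (0:ℝ), 1 - ε < binomialSum n k p := by
      refine ((continuous_binomialSum n k).tendsto 0).mono_left nhdsWithin_le_nhds
        |>.eventually_const_lt ?_
      rw [binomialSum_zero]
      linarith
    filter_upwards [h] with p hp
    have := gaussianPhi_le_one (signedRoot x p (n * bernoulliKL x p))
    linarith
  -- As `p → 1` the Chernoff bound makes `Φ(G)` at most `exp (-n * D)`, which tends to `0` because
  -- `k < n`.
  · intro ε hε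
    have h : ∀ᶠ p in 𝓝[<] (1:ℝ), M * (p ^ k * (1 - p) ^ (n - k)) < ε := by
      have hc : Continuous fun p : ℝ => M * (p ^ k * (1 - p) ^ (n - k)) := by fun_prop
      refine (hc.tendsto 1).mono_left nhdsWithin_le_nhds |>.eventually_lt_const ?_
      simpa [(Nat.sub_pos_of_lt hkn).ne'] using hε
    filter_upwards [h, Ioo_mem_nhdsLT hx.2] with p hp hpx
    have hp1 : p ∈ Set.Ioo (0:ℝ) 1 := ⟨hx.1.trans hpx.1, hpx.2⟩
    have h2 := gaussianPhi_neg_sqrt_le (mul_nonneg hn'.le (bernoulliKL_nonneg hx hp1))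
    rw [exp_neg_mul_bernoulliKL hk hkn hp1] at h2
    have h3 := binomialSum_nonneg n k hp1.1.le hp1.2.le
    simp only [signedRoot, if_pos hpx.1]
    linarith

lemma gaussianPhi_signedRoot_le_binomialSum {n k : ℕ} (hkn : k < n) {p : ℝ}
    (hp : p ∈ Set.Ioo (0:ℝ) 1) :
    gaussianPhi (signedRoot k (n * p) (n * bernoulliKL (k / n) p)) ≤ binomialSum n k p := by
  have hn' : (0:ℝ) < n := by exact_mod_cast (Nat.zero_le k).trans_lt hkn
  have e : signedRoot k (n * p) (n * bernoulliKL (k / n) p) =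
      signedRoot (k / n) p (n * bernoulliKL (k / n) p) := by
    simp only [signedRoot, div_lt_iff₀' hn']
  rw [e]
  rcases Nat.eq_zero_or_pos k with rfl | hk
  -- For `k = 0` the Chernoff bound is `(1 - p) ^ n`, which equals `Pr(K = 0)`.
  · have h4 : 0 < 1 - p := sub_pos.2 hp.2
    have e2 : bernoulliKL 0 p = -Real.log (1 - p) := by simp [bernoulliKL]
    have hl : Real.log (1 - p) ≤ 0 := Real.log_nonpos h4.le (by linarith [hp.1])
    simp only [Nat.cast_zero, zero_div, signedRoot, if_pos hp.1, e2]
    refine (gaussianPhi_neg_sqrt_le (mul_nonneg hn'.le (neg_nonneg.2 hl))).trans (le_of_eq ?_)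
    rw [mul_neg, neg_neg, Real.exp_nat_mul, Real.exp_log h4]
    simp [binomialSum]
  · exact gaussianPhi_signedRoot_le_binomialSum_of_pos hk hkn hp

/-- The lower bound follows from the upper bound by exchanging successes and failures. -/
lemma binomialSum_le_gaussianPhi_signedRoot {n k : ℕ} (hkn : k + 1 ≤ n) {p : ℝ}
    (hp : p ∈ Set.Ioo (0:ℝ) 1) :
    binomialSum n k p ≤ gaussianPhi
      (signedRoot (k + 1 : ℕ) (n * p) (n * bernoulliKL ((k + 1 : ℕ) / n) p)) := by
  have hn' : (0:ℝ) < n := by exact_mod_cast (Nat.zero_le k).trans_lt hkn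
  have hq : 1 - p ∈ Set.Ioo (0:ℝ) 1 := ⟨sub_pos.2 hp.2, by linarith [hp.1]⟩
  have h := gaussianPhi_signedRoot_le_binomialSum (n := n) (k := n - (k + 1)) (by omega) hq
  have hsum : binomialSum n (n - (k + 1)) (1 - p) = 1 - binomialSum n k p := by
    have h1 : ∑ j ∈ Finset.range (n + 1), (n.choose j : ℝ) * p ^ j * (1 - p) ^ (n - j) = 1 := by
      have := add_pow p (1 - p) n
      rw [add_sub_cancel, one_pow] at this
      exact (Finset.sum_congr rfl fun j _ => by ring).trans this.symm
    refine eq_sub_of_add_eq' (Eq.trans ?_ h1)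
    rw [← Finset.sum_range_add_sum_Ico _ (show k + 1 ≤ n + 1 by omega), binomialSum,
      binomialSum, add_right_inj, Finset.sum_Ico_eq_sum_range,
      ← Finset.sum_range_reflect, show n - (k + 1) + 1 = n + 1 - (k + 1) by omega]
    refine Finset.sum_congr rfl fun j hj => ?_
    have hj := Finset.mem_range.1 hj
    rw [show n + 1 - (k + 1) - 1 - j = n - (k + 1 + j) by omega,
      Nat.choose_symm (show k + 1 + j ≤ n by omega),
      show n - (n - (k + 1 + j)) = k + 1 + j by omega]
    ring
  have hx : ((n - (k + 1) : ℕ) : ℝ) / n = 1 - ((k + 1 : ℕ) : ℝ) / n := by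
    rw [Nat.cast_sub hkn]
    field_simp
  rw [hsum, hx, bernoulliKL_one_sub] at h
  set d := n * bernoulliKL ((k + 1 : ℕ) / n) p
  have hcast : ((n - (k + 1) : ℕ) : ℝ) = n - (k + 1 : ℕ) := Nat.cast_sub hkn
  have hneg : signedRoot ((n - (k + 1) : ℕ) : ℝ) (n * (1 - p)) d =
      -signedRoot (k + 1 : ℕ) (n * p) d := by
    rw [hcast]
    unfold signedRoot
    -- The exchange reverses the sign of `G`. In a tie both sides take the sign `+`, harmlessly,
    -- because the divergence is then `0`.
    rcases lt_trichotomy ((k + 1 : ℕ) : ℝ) (n * p) with hlt | heq | hgt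
    · rw [if_pos hlt, if_neg (by linarith), neg_neg]
    · have hd : d = 0 := by
        have hxp : ((k + 1 : ℕ) : ℝ) / n = p := by rw [heq]; field_simp
        simp only [d, hxp, bernoulliKL_self hp, mul_zero]
      simp [hd]
    · rw [if_neg (not_lt.2 hgt.le), if_pos (by linarith)]
  rw [hneg, gaussianPhi_neg] at h
  linarith

/-! ### The Poisson distribution function as a limit -/

/-- The divergence `D(Po x ‖ Po r)`. -/
noncomputable def poissonKL (x r : ℝ) : ℝ := x * Real.log (x / r) + r - x

/-- The probability that a Poisson variable is at most `k`. -/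
noncomputable def poissonSum (k : ℕ) (r : ℝ) : ℝ :=
  ∑ j ∈ Finset.range (k + 1), Real.exp (-r) * r ^ j / j.factorial

section

variable {r : ℝ}

/-- Since `(1 - k / n) / (1 - r / n) = 1 + (r - k) / (n - r)`, the failure term tends to `r - k` by
`t * log (1 + c / t) → c` with `t = n - r`. -/
lemma tendsto_mul_bernoulliKL_div (hr : 0 < r) (k : ℕ) :
    Tendsto (fun n : ℕ => n * bernoulliKL (k / n) (r / n)) atTop (𝓝 (poissonKL k r)) := by
  have ht : Tendsto (fun n : ℕ => (n : ℝ) - r) atTop atTop :=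
    tendsto_atTop_add_const_right _ _ tendsto_natCast_atTop_atTop
  have h1 := (Real.tendsto_mul_log_one_add_div_atTop (r - k)).comp ht
  have h2 : Tendsto (fun n : ℕ => Real.log (1 + (r - k) / ((n : ℝ) - r))) atTop (𝓝 0) := by
    have := (ht.const_div_atTop (r - k)).const_add 1
    rw [add_zero] at this
    simpa using this.log one_ne_zero
  have h3 := ((h1.add (h2.const_mul (r - k))).const_add (k * Real.log (k / r)))
  have e : k * Real.log (k / r) + (r - k + (r - k) * 0) = poissonKL k r := by
    rw [poissonKL]; ring
  rw [e] at h3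
  refine h3.congr' ?_
  filter_upwards [eventually_gt_atTop 0, ht.eventually_gt_atTop 0] with n hn hnr
  have hn' : (0:ℝ) < n := by exact_mod_cast hn
  have e1 : (k / n : ℝ) / (r / n) = k / r := by field_simp
  have e2 : (1 - k / n : ℝ) / (1 - r / n) = 1 + (r - k) / (n - r) := by
    have : 1 - r / n ≠ 0 := by
      rw [show 1 - r / n = (n - r) / n by field_simp]
      positivity
    field_simp
    ring
  simp only [Function.comp_apply, bernoulliKL, e1, e2]
  field_simp
  ring

lemma tendsto_signedRoot (hr : 0 < r) (k : ℕ) :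
    Tendsto (fun n : ℕ => signedRoot k (n * (r / n)) (n * bernoulliKL (k / n) (r / n))) atTop
      (𝓝 (signedRoot k r (poissonKL k r))) := by
  have h := ((tendsto_mul_bernoulliKL_div hr k).const_mul 2).sqrt
  have e : ∀ᶠ n : ℕ in atTop, (n : ℝ) * (r / n) = r := by
    filter_upwards [eventually_gt_atTop 0] with n hn
    have hn' : (0:ℝ) < n := by exact_mod_cast hn
    field_simp
  by_cases hk : (k : ℝ) < r
  · simp only [signedRoot, if_pos hk]
    refine h.neg.congr' ?_
    filter_upwards [e] with n hn
    rw [hn, if_pos hk]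
  · simp only [signedRoot, if_neg hk]
    refine h.congr' ?_
    filter_upwards [e] with n hn
    rw [hn, if_neg hk]

lemma tendsto_binomialSum (hr : 0 < r) (k : ℕ) :
    Tendsto (fun n : ℕ => binomialSum n k (r / n)) atTop (𝓝 (poissonSum k r)) := by
  refine tendsto_finsetSum _ fun j _ => ?_
  refine tendsto_choose_mul_pow_of_tendsto_mul_atTop j (tendsto_const_nhds.congr' ?_)
  filter_upwards [eventually_gt_atTop 0] with n hn
  have hn' : (0:ℝ) < n := by exact_mod_cast hn
  field_simp

lemma eventually_div_mem_Ioo (hr : 0 < r) : ∀ᶠ n : ℕ in atTop, r / n ∈ Set.Ioo (0:ℝ) 1 := by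
  filter_upwards [(tendsto_natCast_atTop_atTop (R := ℝ)).eventually_gt_atTop r] with n hn
  have hn' : (0:ℝ) < n := hr.trans hn
  exact ⟨by positivity, (div_lt_one hn').2 hn⟩

lemma gaussianPhi_signedRoot_le_poissonSum (hr : 0 < r) (k : ℕ) :
    gaussianPhi (signedRoot k r (poissonKL k r)) ≤ poissonSum k r := by
  refine le_of_tendsto_of_tendsto ((continuous_gaussianPhi.tendsto _).comp (tendsto_signedRoot hr k))
    (tendsto_binomialSum hr k) ?_
  filter_upwards [eventually_gt_atTop k, eventually_div_mem_Ioo hr] with n hn hp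
  exact gaussianPhi_signedRoot_le_binomialSum hn hp

lemma poissonSum_le_gaussianPhi_signedRoot (hr : 0 < r) (k : ℕ) :
    poissonSum k r ≤ gaussianPhi (signedRoot (k + 1 : ℕ) r (poissonKL (k + 1 : ℕ) r)) := by
  refine le_of_tendsto_of_tendsto (tendsto_binomialSum hr k)
    ((continuous_gaussianPhi.tendsto _).comp (tendsto_signedRoot hr (k + 1))) ?_
  filter_upwards [eventually_ge_atTop (k + 1), eventually_div_mem_Ioo hr] with n hn hp
  exact binomialSum_le_gaussianPhi_signedRoot hn hp

end

/-! ### Members of an exponential family and its end points -/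

section

variable {P₀ : Measure ℝ}

lemma IsExpFamilyLimit.unique {l : Filter ℝ} [l.NeBot] {Q Q' : Measure ℝ} [IsFiniteMeasure Q]
    [IsFiniteMeasure Q'] (h : IsExpFamilyLimit P₀ l Q) (h' : IsExpFamilyLimit P₀ l Q') : Q = Q' :=
  ext_of_forall_integral_eq_of_IsFiniteMeasure fun f => tendsto_nhds_unique (h f) (h' f)

lemma isMeanValueMember_dirac {a : ℝ} (h : IsExpFamilyLimit P₀ atBot (Measure.dirac a) ∨
    IsExpFamilyLimit P₀ atTop (Measure.dirac a)) :
    IsMeanValueMember P₀ a (Measure.dirac a) where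
  isProbabilityMeasure := inferInstance
  mem := Or.inr h
  integrable := integrable_dirac (by simp)
  mean := integral_dirac _ _

/-- `meanValueMember` is an arbitrary choice, so the divergence must be computed for every member
with mean `x`. -/
lemma signedLogLikelihood_eq {x d : ℝ} (hex : ∃ Q, IsMeanValueMember P₀ x Q)
    (huniq : ∀ Q, IsMeanValueMember P₀ x Q → (InformationTheory.klDiv Q P₀).toReal = d) :
    signedLogLikelihood P₀ x = signedRoot x (∫ y, y ∂P₀) d := by
  have h : (InformationTheory.klDiv (meanValueMember P₀ x) P₀).toReal = d := by
    rw [meanValueMember, dif_pos hex]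
    exact huniq _ hex.choose_spec
  rw [signedLogLikelihood, signedRoot, h]

lemma mem_interior_integrableExpSet (hint : ∀ β, Integrable (fun x => Real.exp (β * x)) P₀)
    (β : ℝ) : β ∈ interior (integrableExpSet id P₀) := by
  have : integrableExpSet id P₀ = Set.univ := Set.eq_univ_of_forall hint
  simp [this]

lemma integral_id_expFamily (hint : ∀ β, Integrable (fun x => Real.exp (β * x)) P₀) (β : ℝ) :
    ∫ x, x ∂(expFamily P₀ β) = deriv (cgf id P₀) β :=
  integral_tilted_mul_self (mem_interior_integrableExpSet hint β)

variable [IsProbabilityMeasure P₀]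

lemma isMeanValueMember_expFamily (hint : ∀ β, Integrable (fun x => Real.exp (β * x)) P₀)
    (β : ℝ) : IsMeanValueMember P₀ (deriv (cgf id P₀) β) (expFamily P₀ β) where
  isProbabilityMeasure := isProbabilityMeasure_tilted (hint β)
  mem := Or.inl ⟨β, hint β, rfl⟩
  integrable := memLp_one_iff_integrable.1
    (memLp_tilted_mul (mem_interior_integrableExpSet hint β) 1)
  mean := integral_id_expFamily hint β

lemma integral_id_eq_deriv_cgf (hint : ∀ β, Integrable (fun x => Real.exp (β * x)) P₀) :
    ∫ x, x ∂P₀ = deriv (cgf id P₀) 0 := by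
  rw [← integral_id_expFamily hint 0]
  simp [expFamily]

lemma toReal_klDiv_expFamily (hint : ∀ β, Integrable (fun x => Real.exp (β * x)) P₀) (β : ℝ) :
    (InformationTheory.klDiv (expFamily P₀ β) P₀).toReal =
      β * deriv (cgf id P₀) β - cgf id P₀ β := by
  have hac : expFamily P₀ β ≪ P₀ := tilted_absolutelyContinuous _ _
  have hM := isMeanValueMember_expFamily hint β
  have := hM.isProbabilityMeasure
  rw [InformationTheory.toReal_klDiv_of_measure_eq hac (by simp)]
  have h : llr (expFamily P₀ β) P₀ =ᵐ[expFamily P₀ β] fun x => β * x - cgf id P₀ β := by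
    refine hac.ae_eq ?_
    filter_upwards [llr_tilted_left (Measure.AbsolutelyContinuous.refl P₀) (hint β)
      (by fun_prop), llr_self P₀] with x h1 h2
    rw [expFamily, h1, h2]
    simp [cgf, mgf]
  rw [integral_congr_ae h, integral_sub (hM.integrable.const_mul β) (integrable_const _),
    integral_const_mul, hM.mean]
  simp

lemma toReal_klDiv_dirac {a : ℝ} (ha : P₀ {a} ≠ 0) :
    (InformationTheory.klDiv (Measure.dirac a) P₀).toReal = -Real.log (P₀.real {a}) := by
  have hac : Measure.dirac a ≪ P₀ := by
    refine Measure.AbsolutelyContinuous.mk fun s hs hs0 => ?_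
    rw [Measure.dirac_apply' _ hs, Set.indicator_of_notMem]
    exact fun has => ha (measure_mono_null (Set.singleton_subset_iff.2 has) hs0)
  rw [InformationTheory.toReal_klDiv_of_measure_eq hac (by simp), integral_dirac, llr]
  -- Evaluating on `{a}` shows that the density of the point mass at `a` is `1 / P₀ {a}`.
  have h := congrArg (fun μ => μ {a}) (Measure.withDensity_rnDeriv_eq (Measure.dirac a) P₀ hac)
  simp only [withDensity_apply _ (measurableSet_singleton a), lintegral_singleton,
    Measure.dirac_apply_of_mem (Set.mem_singleton a)] at h
  rw [ENNReal.eq_inv_of_mul_eq_one_left h, ENNReal.toReal_inv, Real.log_inv, measureReal_def]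

/-- Centred at `a`, the weights are bounded by `1` and tend to the indicator of `{a}`, so dominated
convergence applies. -/
lemma tendsto_integral_exp_mul_sub {l : Filter ℝ} [l.IsCountablyGenerated] {a : ℝ}
    (h1 : ∀ᶠ β in l, ∀ᵐ x ∂P₀, β * (x - a) ≤ 0)
    (h2 : ∀ᵐ x ∂P₀, x = a ∨ Tendsto (fun β => β * (x - a)) l atBot) (f : ℝ →ᵇ ℝ) :
    Tendsto (fun β => ∫ x, Real.exp (β * (x - a)) * f x ∂P₀) l (𝓝 (P₀.real {a} * f a)) := by
  have e : ∫ x, ({a} : Set ℝ).indicator f x ∂P₀ = P₀.real {a} * f a := by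
    rw [integral_indicator (measurableSet_singleton a), integral_singleton, smul_eq_mul]
  rw [← e]
  refine tendsto_integral_filter_of_dominated_convergence (fun _ => ‖f‖) ?_ ?_
    (integrable_const _) ?_
  · exact Eventually.of_forall fun β => (by fun_prop : Continuous fun x =>
      Real.exp (β * (x - a)) * f x).aestronglyMeasurable
  · filter_upwards [h1] with β hβ
    filter_upwards [hβ] with x hx
    rw [norm_mul, Real.norm_eq_abs, Real.abs_exp]
    exact (mul_le_of_le_one_left (norm_nonneg _) (Real.exp_le_one_iff.2 hx)).trans
      (f.norm_coe_le_norm x)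
  · filter_upwards [h2] with x hx
    rcases eq_or_ne x a with rfl | hne
    · simpa using tendsto_const_nhds
    · have := (Real.tendsto_exp_atBot.comp (hx.resolve_left hne)).mul_const (f x)
      simpa [hne] using this

lemma isExpFamilyLimit_dirac {l : Filter ℝ} [l.IsCountablyGenerated] {a : ℝ}
    (h1 : ∀ᶠ β in l, ∀ᵐ x ∂P₀, β * (x - a) ≤ 0)
    (h2 : ∀ᵐ x ∂P₀, x = a ∨ Tendsto (fun β => β * (x - a)) l atBot) (ha : P₀ {a} ≠ 0) :
    IsExpFamilyLimit P₀ l (Measure.dirac a) := by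
  intro f
  have ha' : P₀.real {a} ≠ 0 := (measureReal_ne_zero_iff (by simp)).2 ha
  have hlim := (tendsto_integral_exp_mul_sub h1 h2 f).div
    (tendsto_integral_exp_mul_sub h1 h2 (BoundedContinuousFunction.const ℝ 1)) (by simpa using ha')
  rw [integral_dirac]
  have e : P₀.real {a} * f a / (P₀.real {a} * BoundedContinuousFunction.const ℝ (1:ℝ) a) = f a := by
    simp only [BoundedContinuousFunction.const_apply, mul_one]
    field_simp
  rw [e] at hlim
  refine hlim.congr fun β => ?_
  -- The factor `exp (β * a)` cancels between numerator and normaliser, leaving a quotient of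
  -- centred integrals.
  have hexp : ∀ x, Real.exp (β * x) = Real.exp (β * a) * Real.exp (β * (x - a)) := fun x => by
    rw [← Real.exp_add]; ring_nf
  rw [expFamily, integral_tilted]
  have hZ : ∫ x, Real.exp (β * x) ∂P₀ = Real.exp (β * a) * ∫ x, Real.exp (β * (x - a)) ∂P₀ := by
    rw [← integral_const_mul]
    exact integral_congr_ae (Eventually.of_forall hexp)
  simp only [BoundedContinuousFunction.const_apply, mul_one, smul_eq_mul, Pi.div_apply]
  rw [hZ, ← integral_div]
  congr 1
  funext x
  rw [hexp x, mul_div_mul_left _ _ (Real.exp_pos _).ne']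
  ring

lemma isExpFamilyLimit_atBot {a : ℝ} (h : ∀ᵐ x ∂P₀, a ≤ x) (ha : P₀ {a} ≠ 0) :
    IsExpFamilyLimit P₀ atBot (Measure.dirac a) := by
  refine isExpFamilyLimit_dirac ?_ ?_ ha
  · filter_upwards [eventually_le_atBot 0] with β hβ
    filter_upwards [h] with x hx
    exact mul_nonpos_of_nonpos_of_nonneg hβ (sub_nonneg.2 hx)
  · filter_upwards [h] with x hx
    rcases hx.eq_or_lt with rfl | hlt
    · exact Or.inl rfl
    · exact Or.inr (tendsto_id.atBot_mul_const (sub_pos.2 hlt))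

lemma isExpFamilyLimit_atTop {a : ℝ} (h : ∀ᵐ x ∂P₀, x ≤ a) (ha : P₀ {a} ≠ 0) :
    IsExpFamilyLimit P₀ atTop (Measure.dirac a) := by
  refine isExpFamilyLimit_dirac ?_ ?_ ha
  · filter_upwards [eventually_ge_atTop 0] with β hβ
    filter_upwards [h] with x hx
    exact mul_nonpos_of_nonneg_of_nonpos hβ (sub_nonpos.2 hx)
  · filter_upwards [h] with x hx
    rcases hx.eq_or_lt with rfl | hlt
    · exact Or.inl rfl
    · exact Or.inr (tendsto_id.atTop_mul_const_of_neg (sub_neg.2 hlt))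

end

/-! ### The binomial family -/

section

variable {n : ℕ} {p : unitInterval}

instance isProbabilityMeasure_binReal : IsProbabilityMeasure (binReal n p) :=
  isProbabilityMeasure_map_cast_binomial

lemma integrable_exp_binReal (β : ℝ) :
    Integrable (fun x => Real.exp (β * x)) (binReal n p) :=
  integrable_map_cast_binomial _

lemma cgf_binReal (β : ℝ) :
    cgf id (binReal n p) β = n * Real.log (1 - p + p * Real.exp β) := by
  rw [cgf, mgf, binReal, integral_map_cast_binomial, ← Real.log_pow, add_comm (1 - (p : ℝ)),
    add_pow, Nat.range_succ_eq_Iic]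
  congr 1
  refine Finset.sum_congr rfl fun k _ => ?_
  rw [mul_pow, ← Real.exp_nat_mul, id, smul_eq_mul, mul_comm β]
  ring

lemma one_sub_add_mul_exp_pos (hp : (p : ℝ) < 1) (β : ℝ) : 0 < 1 - (p : ℝ) + p * Real.exp β := by
  have := mul_nonneg p.2.1 (Real.exp_pos β).le
  linarith

lemma deriv_cgf_binReal (hp : (p : ℝ) < 1) (β : ℝ) :
    deriv (cgf id (binReal n p)) β = n * (p * Real.exp β / (1 - p + p * Real.exp β)) := by
  rw [show cgf id (binReal n p) = _ from funext cgf_binReal]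
  exact (((((Real.hasDerivAt_exp β).const_mul (p : ℝ)).const_add (1 - (p : ℝ))).log
    (one_sub_add_mul_exp_pos hp β).ne').const_mul (n : ℝ)).deriv

lemma ae_mem_Icc_binReal : ∀ᵐ x ∂(binReal n p), x ∈ Set.Icc (0:ℝ) n := by
  refine (ae_map_iff .of_discrete measurableSet_Icc).2 ?_
  filter_upwards [ae_le_of_hasLaw_binomial (HasLaw.id (μ := binomial n p))] with k hk
  exact ⟨by positivity, by exact_mod_cast hk⟩

lemma binReal_real_zero : (binReal n p).real {0} = (1 - p : ℝ) ^ n :=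
  map_cast_binomial_real_zero n p

lemma binReal_real_self : (binReal n p).real {(n : ℝ)} = (p : ℝ) ^ n :=
  map_cast_binomial_real_self n p

lemma isExpFamilyLimit_binReal_atBot (hp1 : (p : ℝ) < 1) :
    IsExpFamilyLimit (binReal n p) atBot (Measure.dirac 0) := by
  refine isExpFamilyLimit_atBot (ae_mem_Icc_binReal.mono fun x hx => hx.1) ?_
  rw [← measureReal_ne_zero_iff (by simp), binReal_real_zero]
  exact pow_ne_zero _ (sub_pos.2 hp1).ne'

lemma isExpFamilyLimit_binReal_atTop (hp0 : 0 < (p : ℝ)) :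
    IsExpFamilyLimit (binReal n p) atTop (Measure.dirac (n : ℝ)) := by
  refine isExpFamilyLimit_atTop (ae_mem_Icc_binReal.mono fun x hx => hx.2) ?_
  rw [← measureReal_ne_zero_iff (by simp), binReal_real_self]
  exact pow_ne_zero _ hp0.ne'

lemma signedLogLikelihood_binReal (hp0 : 0 < (p : ℝ)) (hp1 : (p : ℝ) < 1) {k : ℕ} (hn : 0 < n)
    (hkn : k ≤ n) : signedLogLikelihood (binReal n p) k =
      signedRoot k (n * p) (n * bernoulliKL (k / n) p) := by
  have hn' : (0:ℝ) < n := by exact_mod_cast hn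
  have hq : 0 < 1 - (p : ℝ) := sub_pos.2 hp1
  have hmean : ∫ y, y ∂(binReal n p) = n * p := by
    rw [integral_id_eq_deriv_cgf integrable_exp_binReal, deriv_cgf_binReal hp1]
    simp
  rw [← hmean]
  refine signedLogLikelihood_eq ?_ ?_
  · rcases Nat.eq_zero_or_pos k with rfl | hk
    · exact ⟨_, by simpa using
        isMeanValueMember_dirac (Or.inl (isExpFamilyLimit_binReal_atBot (n := n) hp1))⟩
    rcases hkn.eq_or_lt with rfl | hlt
    · exact ⟨_, isMeanValueMember_dirac (Or.inr (isExpFamilyLimit_binReal_atTop hp0))⟩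
    have hk' : (0:ℝ) < k := by exact_mod_cast hk
    have hlt' : 0 < (n : ℝ) - k := sub_pos.2 (by exact_mod_cast hlt)
    -- This `β` solves `n * p * exp β / (1 - p + p * exp β) = k`.
    refine ⟨expFamily (binReal n p) (Real.log (k * (1 - p) / ((n - k) * p))), ?_⟩
    convert isMeanValueMember_expFamily integrable_exp_binReal _
    rw [deriv_cgf_binReal hp1, Real.exp_log (by positivity)]
    field_simp
    ring
  · intro Q hQ
    have := hQ.isProbabilityMeasure
    rcases hQ.mem with ⟨β, -, rfl⟩ | hl | hl
    · have hm := hQ.mean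
      rw [integral_id_expFamily integrable_exp_binReal] at hm
      rw [toReal_klDiv_expFamily integrable_exp_binReal, hm, cgf_binReal]
      rw [deriv_cgf_binReal hp1] at hm
      have hZ := one_sub_add_mul_exp_pos hp1 β
      have hu := Real.exp_pos β
      have hx : (k : ℝ) / n = p * Real.exp β / (1 - p + p * Real.exp β) := by
        rw [← hm]; field_simp
      have e1 : (k : ℝ) / n / p = Real.exp β / (1 - p + p * Real.exp β) := by
        rw [hx]; field_simp
      have e2 : (1 - (k : ℝ) / n) / (1 - p) = (1 - p + p * Real.exp β)⁻¹ := by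
        rw [hx]; field_simp; ring
      rw [bernoulliKL, e1, e2, Real.log_inv, Real.log_div hu.ne' hZ.ne', Real.log_exp]
      field_simp
      ring
    -- Here `Q` is the point mass at `0`, so its mean forces `k = 0`.
    · have hQe := hl.unique (isExpFamilyLimit_binReal_atBot hp1)
      have hm := hQ.mean
      rw [hQe, integral_dirac] at hm
      rw [hQe, toReal_klDiv_dirac, binReal_real_zero, ← hm, Real.log_pow]
      · simp [bernoulliKL]
      · rw [← measureReal_ne_zero_iff (by simp), binReal_real_zero]
        positivity
    · have hQe := hl.unique (isExpFamilyLimit_binReal_atTop hp0)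
      have hm := hQ.mean
      rw [hQe, integral_dirac] at hm
      rw [hQe, toReal_klDiv_dirac, binReal_real_self, ← hm, Real.log_pow]
      · simp [bernoulliKL, hn'.ne']
      · rw [← measureReal_ne_zero_iff (by simp), binReal_real_self]
        positivity

end

/-! ### The Poisson family -/

section

variable {r : ℝ≥0}

instance isProbabilityMeasure_poissonReal : IsProbabilityMeasure (poissonReal r) :=
  Measure.isProbabilityMeasure_map .of_discrete

lemma hasSum_poisson_mul_exp (r β : ℝ) :
    HasSum (fun k : ℕ => Real.exp (-r) * r ^ k / k.factorial * Real.exp (β * k))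
      (Real.exp (r * (Real.exp β - 1))) := by
  have h := (NormedSpace.expSeries_div_hasSum_exp (r * Real.exp β)).mul_left (Real.exp (-r))
  rw [← Real.exp_eq_exp_ℝ, ← Real.exp_add] at h
  rw [show r * (Real.exp β - 1) = -r + r * Real.exp β by ring]
  refine h.congr_fun fun k => ?_
  rw [mul_comm β, Real.exp_nat_mul, mul_pow]
  ring

lemma integrable_exp_poissonReal (β : ℝ) :
    Integrable (fun x => Real.exp (β * x)) (poissonReal r) := by
  rw [poissonReal, integrable_map_measure (by fun_prop) .of_discrete, integrable_poissonMeasure_iff]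
  simpa using (hasSum_poisson_mul_exp r β).summable

lemma mgf_poissonReal (β : ℝ) :
    mgf id (poissonReal r) β = Real.exp (r * (Real.exp β - 1)) := by
  rw [mgf, poissonReal, integral_map .of_discrete (by fun_prop), integral_poissonMeasure]
  exact (hasSum_poisson_mul_exp r β).tsum_eq

lemma cgf_poissonReal (β : ℝ) : cgf id (poissonReal r) β = r * (Real.exp β - 1) := by
  rw [cgf, mgf_poissonReal, Real.log_exp]

lemma deriv_cgf_poissonReal (β : ℝ) :
    deriv (cgf id (poissonReal r)) β = r * Real.exp β := by
  rw [show cgf id (poissonReal r) = _ from funext cgf_poissonReal]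
  exact (((Real.hasDerivAt_exp β).sub_const 1).const_mul (r : ℝ)).deriv

lemma ae_nonneg_poissonReal : ∀ᵐ x ∂(poissonReal r), (0:ℝ) ≤ x := by
  rw [poissonReal, ae_map_iff (by fun_prop) measurableSet_Ici]
  exact Eventually.of_forall fun k => by positivity

lemma poissonReal_real_zero : (poissonReal r).real {0} = Real.exp (-r) := by
  rw [poissonReal, map_measureReal_apply (by fun_prop) (by measurability)]
  have : (Nat.cast : ℕ → ℝ) ⁻¹' {0} = {0} := by ext; simp
  rw [this, poissonMeasure_real_singleton]
  simp

lemma isExpFamilyLimit_poissonReal_atBot :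
    IsExpFamilyLimit (poissonReal r) atBot (Measure.dirac 0) := by
  refine isExpFamilyLimit_atBot ae_nonneg_poissonReal ?_
  rw [← measureReal_ne_zero_iff (by simp), poissonReal_real_zero]
  positivity

/-- Mass escapes to infinity. Integrating `exp (-x)` against `P_β` gives the ratio of the moment
generating function at `β - 1` and `β`, which tends to `0`, whereas a probability measure gives a
positive integral. -/
lemma not_isExpFamilyLimit_poissonReal_atTop (hr : 0 < r) {Q : Measure ℝ}
    [IsProbabilityMeasure Q] : ¬ IsExpFamilyLimit (poissonReal r) atTop Q := by
  intro h
  have hr' : (0:ℝ) < r := hr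
  let f : ℝ →ᵇ ℝ := BoundedContinuousFunction.ofNormedAddCommGroup
    (fun x => Real.exp (-max x 0)) (by fun_prop) 1 (fun x => by simp)
  have hf : ∀ x, f x = Real.exp (-max x 0) := fun x => rfl
  have hpos : 0 < ∫ x, f x ∂Q := by
    rw [integral_pos_iff_support_of_nonneg (f := f)
      (fun x => (hf x).symm ▸ (Real.exp_pos _).le) (f.integrable Q)]
    have : Function.support f = Set.univ := by
      ext x; simp [hf]
    simp [this]
  have hint : ∀ β, ∫ x, f x ∂(expFamily (poissonReal r) β) =
      Real.exp (-(r * (1 - Real.exp (-1)) * Real.exp β)) := by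
    intro β
    have e : ∫ x, f x ∂(expFamily (poissonReal r) β) =
        mgf id (poissonReal r) (β - 1) / mgf id (poissonReal r) β := by
      rw [expFamily, integral_tilted, mgf, mgf, ← integral_div]
      refine integral_congr_ae ?_
      filter_upwards [ae_nonneg_poissonReal] with x hx
      simp only [hf, id, max_eq_left hx, smul_eq_mul]
      rw [div_mul_eq_mul_div, ← Real.exp_add]
      ring_nf
    rw [e, mgf_poissonReal, mgf_poissonReal, ← Real.exp_sub, sub_eq_add_neg β, Real.exp_add]
    ring_nf
  have hlim : Tendsto (fun β => ∫ x, f x ∂(expFamily (poissonReal r) β)) atTop (𝓝 0) := by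
    simp only [hint]
    have h1 : 0 < 1 - Real.exp (-1) := sub_pos.2 (by simp)
    exact Real.tendsto_exp_neg_atTop_nhds_zero.comp
      (Real.tendsto_exp_atTop.const_mul_atTop (by positivity))
  exact hpos.ne' (tendsto_nhds_unique (h f) hlim)

lemma signedLogLikelihood_poissonReal (hr : 0 < r) (k : ℕ) :
    signedLogLikelihood (poissonReal r) k = signedRoot k r (poissonKL k r) := by
  have hr' : (0:ℝ) < r := hr
  have hmean : ∫ y, y ∂(poissonReal r) = r := by
    rw [integral_id_eq_deriv_cgf integrable_exp_poissonReal, deriv_cgf_poissonReal]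
    simp
  conv_rhs => enter [2]; rw [← hmean]
  refine signedLogLikelihood_eq ?_ ?_
  · rcases Nat.eq_zero_or_pos k with rfl | hk
    · exact ⟨_, by simpa using
        isMeanValueMember_dirac (Or.inl (isExpFamilyLimit_poissonReal_atBot (r := r)))⟩
    have hk' : (0:ℝ) < k := by exact_mod_cast hk
    refine ⟨expFamily (poissonReal r) (Real.log (k / r)), ?_⟩
    convert isMeanValueMember_expFamily integrable_exp_poissonReal _
    rw [deriv_cgf_poissonReal, Real.exp_log (by positivity)]
    field_simp
  · intro Q hQ
    have := hQ.isProbabilityMeasure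
    rcases hQ.mem with ⟨β, -, rfl⟩ | hl | hl
    · have hm := hQ.mean
      rw [integral_id_expFamily integrable_exp_poissonReal] at hm
      rw [toReal_klDiv_expFamily integrable_exp_poissonReal, hm, cgf_poissonReal]
      rw [deriv_cgf_poissonReal] at hm
      rw [poissonKL, ← hm, mul_div_cancel_left₀ _ hr'.ne', Real.log_exp]
      ring
    · have hQe := hl.unique isExpFamilyLimit_poissonReal_atBot
      have hm := hQ.mean
      rw [hQe, integral_dirac] at hm
      rw [hQe, toReal_klDiv_dirac, poissonReal_real_zero, ← hm, Real.log_exp]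
      · simp [poissonKL]
      · rw [← measureReal_ne_zero_iff (by simp), poissonReal_real_zero]
        positivity
    · exact absurd hl (not_isExpFamilyLimit_poissonReal_atTop hr)

end

/-! ### Distribution functions as finite sums, and the final assembly -/

lemma binomial_real_setOf_le (n k : ℕ) (p : unitInterval) :
    (binomial n p).real {j | j ≤ k} = binomialSum n k p := by
  have h : {j : ℕ | j ≤ k} = Finset.range (k + 1) := by ext; simp
  rw [h, ← sum_measureReal_singleton, binomialSum]
  exact Finset.sum_congr rfl fun j _ => binomial_real_singleton n j p

lemma poissonMeasure_real_setOf_le (k : ℕ) (r : ℝ≥0) :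
    (poissonMeasure r).real {j | j ≤ k} = poissonSum k r := by
  have h : {j : ℕ | j ≤ k} = Finset.range (k + 1) := by ext; simp
  rw [h, ← sum_measureReal_singleton, poissonSum]
  exact Finset.sum_congr rfl fun j _ => poissonMeasure_real_singleton r j

theorem mainTheorem1 :
    (∀ {Ω : Type*} [MeasurableSpace Ω] (P : Measure Ω) (K : Ω → ℕ)
      (n : ℕ) (p : unitInterval), 0 < p → p < 1 → HasLaw K (binomial n p) P →
      ∀ k : ℕ, k ≤ n →
        P.real {ω | K ω < k} ≤ gaussianPhi (signedLogLikelihood (binReal n p) (k : ℝ)) ∧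
        gaussianPhi (signedLogLikelihood (binReal n p) (k : ℝ)) ≤ P.real {ω | K ω ≤ k}) ∧
    (∀ {Ω : Type*} [MeasurableSpace Ω] (P : Measure Ω) (L : Ω → ℕ)
      (r : ℝ≥0), 0 < r → HasLaw L (poissonMeasure r) P →
      ∀ k : ℕ,
        P.real {ω | L ω < k} ≤ gaussianPhi (signedLogLikelihood (poissonReal r) (k : ℝ)) ∧
        gaussianPhi (signedLogLikelihood (poissonReal r) (k : ℝ)) ≤ P.real {ω | L ω ≤ k}) := by
  refine ⟨?_, ?_⟩
  · intro Ω _ P K n p hp0 hp1 hK k hkn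
    have hp : (p : ℝ) ∈ Set.Ioo (0:ℝ) 1 := ⟨hp0, hp1⟩
    refine ⟨?_, ?_⟩
    · cases k with
      | zero => simpa using gaussianPhi_nonneg _
      | succ k =>
        simp only [Nat.lt_succ_iff]
        rw [hK.measureReal_eq (p := (· ≤ k)) .of_discrete, binomial_real_setOf_le,
          signedLogLikelihood_binReal hp.1 hp.2 (by omega) hkn]
        exact binomialSum_le_gaussianPhi_signedRoot hkn hp
    -- For `k = n` the right-hand probability is `1`. This also covers `n = 0`, where `k / n`
    -- carries no information.
    · rcases hkn.eq_or_lt with rfl | hlt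
      · have := hK.isProbabilityMeasure
        have h : P.real {ω | K ω ≤ k} = 1 := by
          rw [measureReal_congr (eventuallyEq_univ.2 (ae_le_of_hasLaw_binomial hK)), probReal_univ]
        rw [h]
        exact gaussianPhi_le_one _
      · rw [hK.measureReal_eq (p := (· ≤ k)) .of_discrete, binomial_real_setOf_le,
          signedLogLikelihood_binReal hp.1 hp.2 (by omega) hkn]
        exact gaussianPhi_signedRoot_le_binomialSum hlt hp
  · intro Ω _ P L r hr hL k
    refine ⟨?_, ?_⟩
    · cases k with
      | zero => simpa using gaussianPhi_nonneg _
      | succ k =>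
        simp only [Nat.lt_succ_iff]
        rw [hL.measureReal_eq (p := (· ≤ k)) .of_discrete, poissonMeasure_real_setOf_le,
          signedLogLikelihood_poissonReal hr]
        exact poissonSum_le_gaussianPhi_signedRoot hr k
    · rw [hL.measureReal_eq (p := (· ≤ k)) .of_discrete, poissonMeasure_real_setOf_le,
        signedLogLikelihood_poissonReal hr]
      exact gaussianPhi_signedRoot_le_poissonSum hr k
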